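/- \textbf{Lemma (Sufficient conditions for minimality).} Let $\mathcal U\subset\mathbb R^m$ be finite. Let $\mathcal U_{pc}$ be the set of piecewise-constant functions $[0,\infty)\to\mathcal U$ and $PC([0,\infty),\mathbb R^{\mathrm p})$ the set of piecewise-continuous functions. Let $\sigma:\mathbb R\to\mathbb R$ be globally Lipschitz and analytic, and let $N>0$, analytic functions $\xi=(\xi_1,\dots,\xi_N):\mathbb R\to\mathbb R^N$ and polynomials $U_k,V_k$ in $N$ variables, $V_k\neq0$ $(0\le k\le N)$, be such that $\sigma\,V_0(\xi)=U_0(\xi)$ and $\dot\xi_i\,V_i(\xi)=U_i(\xi)$ for $1\le i\le N$. An RNN $\Sigma=(A,B,C,\mathcal U,\sigma,x_0)$ of dimension $n$ is given by $A\in\mathbb R^{n\times n}$, $B\in\mathbb R^{n\times m}$, $C\in\mathbb R^{\mathrm p\times n}$, $x_0\in\mathbb R^n$. It \emph{realizes} $p:\mathcal U_{pc}\to PC([0,\infty),\mathbb R^{\mathrm p})$ if for every $u\in\mathcal U_{pc}$ the absolutely continuous solution of $\dot x=\vec\sigma(Ax+Bu)$, $x(0)=x_0$ (with $\vec\sigma$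 acting componentwise), satisfies $p(u)=Cx$. It is a \emph{$\sigma$-minimal} realization of $p$ if it realizes $p$ and no RNN with the same $\sigma$ and $\mathcal U$ and of smaller dimension realizes $p$. A rational system on $\mathbb R^L$ has equations $\dot\upsilon_i=P_{i,u}(\upsilon)/Q_{i,u}(\upsilon)$, $\upsilon(0)=\upsilon_0$, $y_k=h_{k,1}(\upsilon)/h_{k,2}(\upsilon)$, with polynomials $P_{i,\alpha}$, $h_{k,1}$ and non-zero polynomials $Q_{i,\alpha}$, $h_{k,2}$ $(\alpha\in\mathcal U)$. It is \emph{polynomial} if all $Q_{i,\alpha}$ and $h_{k,2}$ equal $1$. A \emph{solution} is a triple $(\upsilon,u,y)$ with $\upsilon$ absolutely continuous, $u$ piecewise constant and $y$ piecewise continuous, such that $\dot\upsilon_i\,Q_{i,u}(\upsilon)=P_{i,u}(\upsilon)$ almost everywhere and $y_k\,h_{k,2}(\upsilon)=h_{k,1}(\upsilon)$. Its \emph{reachable set} is the set of all $\upsilon(t)$, $t\ge0$, over all solutions with $\upsilon(0)=\upsilon_0$. The system is \emph{algebraically reachable} if no non-zero polynomial vanishes on the reachable set, and \emph{accessible} if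 the reachable set contains a non-empty open set. Its \emph{observation algebra} is the smallest subalgebra of $\mathbb R(X_1,\dots,X_L)$ that contains all $h_{k,1}/h_{k,2}$ and is closed under the formal Lie derivatives along $\sum_i (P_{i,\alpha}/Q_{i,\alpha})\,\partial/\partial X_i$, $\alpha\in\mathcal U$. The system is \emph{algebraically observable} if this algebra equals $\mathbb R[X_1,\dots,X_L]$, and \emph{semi-algebraically observable} if its transcendence degree over $\mathbb R$ is $L$. The \emph{auxiliary rational system} $\mathscr R_{aux}(\Sigma)$ has states $\upsilon_{i,j,\alpha}$ $(1\le i\le N,\ 1\le j\le n,\ \alpha\in\mathcal U)$. Writing $\upsilon_{j,\alpha}=(\upsilon_{1,j,\alpha},\dots,\upsilon_{N,j,\alpha})$, it is given by $$\dot\upsilon_{i,j,\alpha}=\frac{U_i(\upsilon_{j,\alpha})}{V_i(\upsilon_{j,\alpha})}\sum_{l=1}^n a_{j,l}\frac{U_0(\upsilon_{l,\beta})}{V_0(\upsilon_{l,\beta})}\ \text{ if } u=\beta,\qquad \upsilon_{j,\alpha}(0)=\xi\big(e_j^T(Ax_0+B\alpha)\big),$$ $$y_{k,\alpha}=\sum_{l=1}^n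 c_{k,l}\frac{U_0(\upsilon_{l,\alpha})}{V_0(\upsilon_{l,\alpha})},\qquad 1\le k\le\mathrm p,\ \alpha\in\mathcal U,$$ where sums are brought to the common denominator $\prod_{r=1}^n V_0(\upsilon_{r,\cdot})$, without cancellation. Let $\Sigma$ realize $p$. Then $\Sigma$ is a $\sigma$-minimal realization of $p$ if one of the following holds: (i) $\mathscr R_{aux}(\Sigma)$ is semi-algebraically observable and algebraically reachable, and for each $u\in\mathcal U_{pc}$ any two solutions $(\upsilon,u,y)$, $(\upsilon',u,y')$ of it with $\upsilon(0)=\upsilon'(0)=\upsilon_0$ satisfy $\upsilon=\upsilon'$ (this uniqueness holds, for instance, if the functions $V_0(\xi),\dots,V_N(\xi)$ have no zeros on $\mathbb R$); (ii) $\mathscr R_{aux}(\Sigma)$ is polynomial, algebraically observable and algebraically reachable; (iii) $\mathscr R_{aux}(\Sigma)$ is polynomial, algebraically observable and accessible. -/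

import Mathlib

open scoped NNReal

noncomputable section

/-! ### Signals on the time axis `[0, ∞)` -/

/-- `u` is piecewise constant: there are breakpoints `0 = τ 0 < τ 1 < ⋯ → ∞` such that `u` is
constant on each open interval between two successive breakpoints. -/
def PiecewiseConstant {X : Type*} (u : ℝ≥0 → X) : Prop :=
  ∃ τ : ℕ → ℝ≥0, τ 0 = 0 ∧ StrictMono τ ∧ Filter.Tendsto τ Filter.atTop Filter.atTop ∧
    ∀ k, ∃ a, ∀ s ∈ Set.Ioo (τ k) (τ (k + 1)), u s = a

/-- `y` is piecewise continuous: there are breakpoints `0 = τ 0 < τ 1 < ⋯ → ∞` such that `y` is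
continuous on each open interval between two successive breakpoints and has finite one-sided
limits at the end points of that interval. -/
def PiecewiseContinuous {X : Type*} [TopologicalSpace X] (y : ℝ≥0 → X) : Prop :=
  ∃ τ : ℕ → ℝ≥0, τ 0 = 0 ∧ StrictMono τ ∧ Filter.Tendsto τ Filter.atTop Filter.atTop ∧
    ∀ k, ContinuousOn y (Set.Ioo (τ k) (τ (k + 1))) ∧
      (∃ l, Filter.Tendsto y (nhdsWithin (τ k) (Set.Ioi (τ k))) (nhds l)) ∧
      (∃ l, Filter.Tendsto y (nhdsWithin (τ (k + 1)) (Set.Iio (τ (k + 1)))) (nhds l))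

/-- The set of piecewise-constant inputs `[0, ∞) → 𝒰`. -/
def PCInput (𝒰 : Type*) : Type _ := {u : ℝ≥0 → 𝒰 // PiecewiseConstant u}

/-- The set of piecewise-continuous functions `[0, ∞) → X`. -/
def PCSignal (X : Type*) [TopologicalSpace X] : Type _ := {y : ℝ≥0 → X // PiecewiseContinuous y}

/-- Input-output maps, taking piecewise-constant inputs with values in `𝒰` to
piecewise-continuous outputs with values in `ℝ^q`. -/
abbrev IOMap (𝒰 : Type*) (q : ℕ) : Type _ := PCInput 𝒰 → PCSignal (Fin q → ℝ)

/-- The constant extension to negative times of a function on `[0, ∞)`; only its values at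
times `≥ 0` are ever used. -/
def extendTime {X : Type*} (x : ℝ≥0 → X) : ℝ → X := fun t => x t.toNNReal

/-- Absolute continuity of `x : [0, ∞) → X`, i.e. absolute continuity on every `[0, T]`. -/
def AbsCont {X : Type*} [PseudoMetricSpace X] (x : ℝ≥0 → X) : Prop :=
  ∀ T : ℝ≥0, AbsolutelyContinuousOnInterval (extendTime x) 0 T

/-! ### Recurrent neural networks -/

/-- A recurrent neural network `(A, B, C, 𝒰, σ, x₀)` with activation function `σ`, finite
input space `𝒰 ⊂ ℝ^m`, output space `ℝ^q` and state space `ℝ^n` (so its dimension is `n`). -/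
structure RNN (σ : ℝ → ℝ) {m : ℕ} (𝒰 : Finset (Fin m → ℝ)) (q n : ℕ) where
  A : Matrix (Fin n) (Fin n) ℝ
  B : Matrix (Fin n) (Fin m) ℝ
  C : Matrix (Fin q) (Fin n) ℝ
  x₀ : Fin n → ℝ
  /-- The activation function is globally Lipschitz. -/
  lipschitz : ∃ L : ℝ≥0, LipschitzWith L σ

namespace RNN

variable {σ : ℝ → ℝ} {m : ℕ} {𝒰 : Finset (Fin m → ℝ)} {q n : ℕ}

/-- `(x, u, y)` is a solution of the network: `x` is absolutely continuous, `x(0) = x₀`,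
`x' = σ(A x + B u)` (componentwise, at almost every time), and `y = C x`. -/
def IsSolution (S : RNN σ 𝒰 q n) (x : ℝ≥0 → Fin n → ℝ) (u : PCInput 𝒰)
    (y : ℝ≥0 → Fin q → ℝ) : Prop :=
  AbsCont x ∧ x 0 = S.x₀ ∧
  (∀ᵐ t : ℝ, 0 < t →
    HasDerivAt (extendTime x)
      (fun j => σ ((S.A.mulVec (x t.toNNReal) +
        S.B.mulVec (u.1 t.toNNReal : Fin m → ℝ)) j)) t) ∧
  ∀ t, y t = S.C.mulVec (x t)

/-- The network realizes the input-output map `f`. -/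
def Realizes (S : RNN σ 𝒰 q n) (f : IOMap 𝒰 q) : Prop :=
  ∀ u : PCInput 𝒰, ∃ x, S.IsSolution x u (f u).1

/-- `σ`-minimality: the network realizes `f`, and no network with the same activation function
and of smaller dimension realizes `f`. -/
def IsSigmaMinimal (S : RNN σ 𝒰 q n) (f : IOMap 𝒰 q) : Prop :=
  S.Realizes f ∧ ∀ n' < n, ∀ S' : RNN σ 𝒰 q n', ¬ S'.Realizes f

end RNN

/-! ### Rational functions and their derivatives -/

/-- The field `ℝ(X_i : i ∈ ι)` of rational functions. -/
abbrev RatFun (ι : Type) : Type := FractionRing (MvPolynomial ι ℝ)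

/-- The polynomial `a` seen as a rational function. -/
def toRatFun {ι : Type} : MvPolynomial ι ℝ →ₐ[ℝ] RatFun ι :=
  IsScalarTower.toAlgHom ℝ (MvPolynomial ι ℝ) (RatFun ι)

/-- The formal partial derivative of a rational function, by the quotient rule applied to a
representation as a fraction; `ratPDeriv_div` shows that the representation is irrelevant. -/
def ratPDeriv {ι : Type} (i : ι) (g : RatFun ι) : RatFun ι :=
  let a := (IsLocalization.sec (nonZeroDivisors (MvPolynomial ι ℝ)) g).1
  let b := (IsLocalization.sec (nonZeroDivisors (MvPolynomial ι ℝ)) g).2.1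
  toRatFun (MvPolynomial.pderiv i a * b - a * MvPolynomial.pderiv i b) / toRatFun b ^ 2

theorem toRatFun_injective {ι : Type} :
    Function.Injective (toRatFun : MvPolynomial ι ℝ → RatFun ι) :=
  IsFractionRing.injective (MvPolynomial ι ℝ) (RatFun ι)

theorem ratPDeriv_div {ι : Type} (i : ι) (a b : MvPolynomial ι ℝ) (hb : b ≠ 0) :
    ratPDeriv i (toRatFun a / toRatFun b) =
      toRatFun (MvPolynomial.pderiv i a * b - a * MvPolynomial.pderiv i b) / toRatFun b ^ 2 := by
  have inj := @toRatFun_injective ι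
  have ne : ∀ c : MvPolynomial ι ℝ, c ≠ 0 → toRatFun c ≠ 0 := fun c hc h =>
    hc (inj (by rw [h, map_zero]))
  unfold ratPDeriv
  have hs := IsLocalization.sec_spec (nonZeroDivisors (MvPolynomial ι ℝ))
    (toRatFun a / toRatFun b)
  generalize IsLocalization.sec (nonZeroDivisors (MvPolynomial ι ℝ))
    (toRatFun a / toRatFun b) = s at hs ⊢
  obtain ⟨c, d, hd⟩ := s
  have hd0 : d ≠ 0 := nonZeroDivisors.ne_zero hd
  change toRatFun a / toRatFun b * toRatFun d = toRatFun c at hs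
  have h1 : a * d = c * b := by
    apply inj
    rw [map_mul, map_mul, ← hs]
    field_simp [ne b hb]
  have h2 : MvPolynomial.pderiv i a * d + a * MvPolynomial.pderiv i d =
      MvPolynomial.pderiv i c * b + c * MvPolynomial.pderiv i b := by
    have := congrArg (MvPolynomial.pderiv i) h1
    simp only [Derivation.leibniz, smul_eq_mul] at this
    linear_combination this
  change toRatFun (MvPolynomial.pderiv i c * d - c * MvPolynomial.pderiv i d) /
    toRatFun d ^ 2 = _
  rw [div_eq_div_iff (pow_ne_zero 2 (ne d hd0)) (pow_ne_zero 2 (ne b hb)),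
    ← map_pow, ← map_pow, ← map_mul, ← map_mul]
  congr 1
  linear_combination (-(b * d)) * h2 + (b * MvPolynomial.pderiv i d
    + d * MvPolynomial.pderiv i b) * h1

/-! ### Rational systems -/

/-- A rational system with input space `𝒰`, state space `ℝ^ι` and output space `ℝ^κ`:
`v_i' = P_{i,u}(v) / Q_{i,u}(v)`, `y_k = h_{k,1}(v) / h_{k,2}(v)`, `v(0) = v₀`. -/
structure RationalSystem (𝒰 ι κ : Type) where
  P : 𝒰 → ι → MvPolynomial ι ℝ
  Q : 𝒰 → ι → MvPolynomial ι ℝ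
  h₁ : κ → MvPolynomial ι ℝ
  h₂ : κ → MvPolynomial ι ℝ
  v₀ : ι → ℝ
  Q_ne_zero : ∀ α i, Q α i ≠ 0
  h₂_ne_zero : ∀ k, h₂ k ≠ 0

namespace RationalSystem

variable {𝒰 ι κ : Type}

/-- All the denominators are equal to `1`. -/
def IsPolynomial (R : RationalSystem 𝒰 ι κ) : Prop :=
  (∀ α i, R.Q α i = 1) ∧ ∀ k, R.h₂ k = 1

variable [Fintype ι]

/-- `(v, u, y)` is a solution of the rational system. The equations are required after
multiplication by the denominators, so that `v` may pass through their zeros. -/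
def IsSolution (R : RationalSystem 𝒰 ι κ) (v : ℝ≥0 → ι → ℝ) (u : PCInput 𝒰)
    (y : PCSignal (κ → ℝ)) : Prop :=
  AbsCont v ∧
  (∀ᵐ t : ℝ, 0 < t → ∃ w : ι → ℝ, HasDerivAt (extendTime v) w t ∧
    ∀ i, w i * MvPolynomial.eval (v t.toNNReal) (R.Q (u.1 t.toNNReal) i) =
      MvPolynomial.eval (v t.toNNReal) (R.P (u.1 t.toNNReal) i)) ∧
  ∀ t k, y.1 t k * MvPolynomial.eval (v t) (R.h₂ k) = MvPolynomial.eval (v t) (R.h₁ k)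

/-- The states reachable from `v₀`. -/
def reachableSet (R : RationalSystem 𝒰 ι κ) : Set (ι → ℝ) :=
  {z | ∃ v u y t, R.IsSolution v u y ∧ v 0 = R.v₀ ∧ v t = z}

/-- For each input there is at most one state trajectory starting at `v₀`. -/
def HasUniqueTrajectories (R : RationalSystem 𝒰 ι κ) : Prop :=
  ∀ u v v' y y', R.IsSolution v u y → R.IsSolution v' u y' →
    v 0 = R.v₀ → v' 0 = R.v₀ → v = v'

/-- No non-zero polynomial vanishes on the reachable set. -/
def AlgebraicallyReachable (R : RationalSystem 𝒰 ι κ) : Prop :=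
  ∀ g : MvPolynomial ι ℝ, (∀ z ∈ R.reachableSet, MvPolynomial.eval z g = 0) → g = 0

/-- The reachable set contains a non-empty open set. -/
def Accessible (R : RationalSystem 𝒰 ι κ) : Prop :=
  ∃ W : Set (ι → ℝ), IsOpen W ∧ W.Nonempty ∧ W ⊆ R.reachableSet

/-- The Lie derivative along the formal vector field `f_α = ∑ i, (P_{i,α} / Q_{i,α}) ∂/∂X_i`. -/
def lieDeriv (R : RationalSystem 𝒰 ι κ) (α : 𝒰) (g : RatFun ι) : RatFun ι :=
  ∑ i, toRatFun (R.P α i) / toRatFun (R.Q α i) * ratPDeriv i g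

/-- The observation algebra: the smallest subalgebra of the field of rational functions that
contains the outputs `h_{k,1} / h_{k,2}` and is closed under the Lie derivatives along all
`f_α`. -/
def obsAlgebra (R : RationalSystem 𝒰 ι κ) : Subalgebra ℝ (RatFun ι) :=
  sInf {S | (∀ k, toRatFun (R.h₁ k) / toRatFun (R.h₂ k) ∈ S) ∧
    ∀ α, ∀ g ∈ S, R.lieDeriv α g ∈ S}

/-- The observation algebra is the whole polynomial ring. -/
def AlgebraicallyObservable (R : RationalSystem 𝒰 ι κ) : Prop :=
  R.obsAlgebra = (toRatFun : MvPolynomial ι ℝ →ₐ[ℝ] RatFun ι).range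

/-- The transcendence degree of the observation algebra is the dimension of the system. -/
def SemiAlgebraicallyObservable (R : RationalSystem 𝒰 ι κ) : Prop :=
  Algebra.trdeg ℝ R.obsAlgebra = (Fintype.card ι : Cardinal)

end RationalSystem

/-! ### Activation functions and the auxiliary rational system -/

/-- The data of the standing assumption on `σ`: `σ` is analytic, and there are `N > 0` analytic
functions `ξ_1, …, ξ_N` and polynomials `U_k, V_k` in `N` variables such that
`σ V_0(ξ) = U_0(ξ)` and `ξ_i' V_i(ξ) = U_i(ξ)`. The `V_k` are non-zero polynomials, as the
denominators of a rational system have to be. -/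
structure ActivationData (σ : ℝ → ℝ) where
  N : ℕ
  N_pos : 0 < N
  ξ : Fin N → ℝ → ℝ
  U₀ : MvPolynomial (Fin N) ℝ
  V₀ : MvPolynomial (Fin N) ℝ
  U : Fin N → MvPolynomial (Fin N) ℝ
  V : Fin N → MvPolynomial (Fin N) ℝ
  V₀_ne_zero : V₀ ≠ 0
  V_ne_zero : ∀ i, V i ≠ 0
  σ_analytic : ∀ s, AnalyticAt ℝ σ s
  ξ_analytic : ∀ i s, AnalyticAt ℝ (ξ i) s
  σ_eq : ∀ s, σ s * MvPolynomial.eval (fun l => ξ l s) V₀ =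
    MvPolynomial.eval (fun l => ξ l s) U₀
  ξ_eq : ∀ i s, deriv (ξ i) s * MvPolynomial.eval (fun l => ξ l s) (V i) =
    MvPolynomial.eval (fun l => ξ l s) (U i)

/-- The substitution `g ↦ g(X_{j,α})`, where `X_{j,α} = (X_{1,j,α}, …, X_{N,j,α})`. -/
def blockVar {N n : ℕ} {𝒰 : Type} (j : Fin n) (α : 𝒰) :
    MvPolynomial (Fin N) ℝ →ₐ[ℝ] MvPolynomial (Fin N × Fin n × 𝒰) ℝ :=
  MvPolynomial.rename (fun i => (i, j, α))

theorem blockVar_ne_zero {N n : ℕ} {𝒰 : Type} (j : Fin n) (α : 𝒰)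
    {g : MvPolynomial (Fin N) ℝ} (hg : g ≠ 0) : blockVar j α g ≠ 0 := by
  have inj : Function.Injective (fun i : Fin N => (i, j, α)) := fun a b h => by
    simpa using h
  intro h
  exact hg (MvPolynomial.rename_injective _ inj (by simpa [blockVar] using h))

/-- The auxiliary rational system of a network, with states `v_{i,j,α}` and outputs `y_{k,α}`:
`v_{i,j,α}' = U_i(v_{j,α}) / V_i(v_{j,α}) * ∑ l, a_{j,l} U_0(v_{l,β}) / V_0(v_{l,β})` if `u = β`,
`v_{j,α}(0) = ξ(e_jᵀ (A x₀ + B α))`, and `y_{k,α} = ∑ l, c_{k,l} U_0(v_{l,α}) / V_0(v_{l,α})`.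
Sums of fractions are brought to the common denominator `∏ r, V_0(v_{r,β})`. -/
def RNN.auxSystem {σ : ℝ → ℝ} {m : ℕ} {𝒰 : Finset (Fin m → ℝ)} {q n : ℕ}
    (S : RNN σ 𝒰 q n) (D : ActivationData σ) :
    RationalSystem 𝒰 (Fin D.N × Fin n × 𝒰) (Fin q × 𝒰) where
  P β := fun (i, j, α) => blockVar j α (D.U i) *
    ∑ l, MvPolynomial.C (S.A j l) * blockVar l β D.U₀ *
      ∏ r ∈ Finset.univ.erase l, blockVar r β D.V₀
  Q β := fun (i, j, α) => blockVar j α (D.V i) * ∏ r, blockVar r β D.V₀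
  h₁ := fun (k, α) => ∑ l, MvPolynomial.C (S.C k l) * blockVar l α D.U₀ *
      ∏ r ∈ Finset.univ.erase l, blockVar r α D.V₀
  h₂ := fun (_, α) => ∏ r, blockVar r α D.V₀
  v₀ := fun (i, j, α) => D.ξ i ((S.A.mulVec S.x₀ + S.B.mulVec (α : Fin m → ℝ)) j)
  Q_ne_zero := fun β (i, j, α) => mul_ne_zero (blockVar_ne_zero j α (D.V_ne_zero i))
    (Finset.prod_ne_zero_iff.mpr fun r _ => blockVar_ne_zero r β D.V₀_ne_zero)
  h₂_ne_zero := fun (_, α) =>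
    Finset.prod_ne_zero_iff.mpr fun r _ => blockVar_ne_zero r α D.V₀_ne_zero

end

/-!
Suppose that a network `S'` of dimension `n' < n` realizes the same input-output map as `S`. The
transcendence degree of the observation algebra of the auxiliary system of `S` is `N * n * |𝒰|` by
semi-algebraic observability. It is shown to be at most `N * n' * |𝒰|`, a contradiction.

Every element of the observation algebra is obtained from the outputs `C σ(A x + B α)` by iterated
Lie derivatives. The outputs are themselves derivatives of the output `C x` of the network along
constant inputs, so each such element has a counterpart built in the same way from `S'`, and the
two take equal values at states of `S` and `S'` that are reached simultaneously under a common
input (`RNN.Linked.fderiv_eq`, `RNN.obsAlgebra_le_map_commonObs`). The trajectories of the network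
`S` give trajectories of its auxiliary system, and if the latter are unique, they give all of them.
Hence a rational function whose counterpart is zero has a numerator that vanishes on the reachable
set, and is zero by algebraic reachability (`RNN.eq_zero_of_mem_commonObs`). The transcendence
degree therefore does not exceed that of the algebra of counterparts (`RNN.trdeg_obsAlgebra_le`).

The counterparts are considered as analytic functions of the state of `S'`, not as rational
functions, because the denominators of the auxiliary system of `S'` may vanish identically on its
trajectories. In the domain of analytic functions all counterparts are fractions of polynomials in
the `N * n' * |𝒰|` functions `ξ_i((A' x + B' α)_j)` (`RNN.compPreact_mem_auxFrac`,
`RNN.lie_mem_auxFrac`): where `(A' x + B' α)_j` depends on `x`, the equations for `σ` and `ξ` can be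
solved, since algebraic reachability for `S` forbids `V_k(ξ)` to vanish identically
(`RNN.exists_eval_ne_zero`); otherwise the functions in question are constant. This bounds the
transcendence degree (`RNN.trdeg_auxFrac_le`).

For polynomial systems, trajectories are unique by Grönwall's inequality, algebraic observability
implies semi-algebraic observability, and accessibility implies algebraic reachability.
-/

noncomputable section

/-! ### Absolutely continuous solutions of differential equations -/

theorem LipschitzOnWith.comp_absolutelyContinuousOnInterval {X Y : Type*} [PseudoMetricSpace X]
    [PseudoMetricSpace Y] {f : ℝ → X} {g : X → Y} {K : ℝ≥0} {a b : ℝ}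
    (hg : LipschitzOnWith K g (f '' Set.uIcc a b)) (hf : AbsolutelyContinuousOnInterval f a b) :
    AbsolutelyContinuousOnInterval (g ∘ f) a b := by
  rw [absolutelyContinuousOnInterval_iff] at hf ⊢
  intro ε hε
  obtain ⟨δ, hδ, h⟩ := hf (ε / (K + 1)) (by positivity)
  refine ⟨δ, hδ, fun E hE hd => ?_⟩
  have h1 := h E hE hd
  rw [lt_div_iff₀ (by positivity)] at h1
  refine lt_of_le_of_lt ?_ h1
  rw [Finset.sum_mul]
  refine Finset.sum_le_sum fun i hi => ?_
  have h2 := hg.dist_le_mul _ (Set.mem_image_of_mem f (hE.1 i hi).1) _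
    (Set.mem_image_of_mem f (hE.1 i hi).2)
  simp only [Function.comp_apply]
  nlinarith [dist_nonneg (x := f (E.2 i).1) (y := f (E.2 i).2)]

theorem ContDiff.comp_absolutelyContinuousOnInterval {E F : Type*} [NormedAddCommGroup E]
    [NormedSpace ℝ E] [NormedAddCommGroup F] [NormedSpace ℝ F] {f : ℝ → E} {g : E → F} {a b : ℝ}
    (hg : ContDiff ℝ 1 g) (hf : AbsolutelyContinuousOnInterval f a b) :
    AbsolutelyContinuousOnInterval (g ∘ f) a b := by
  have hc : IsCompact (f '' Set.uIcc a b) := isCompact_uIcc.image_of_continuousOn hf.continuousOn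
  obtain ⟨K, hK⟩ := (hg.locallyLipschitz.locallyLipschitzOn
    (s := f '' Set.uIcc a b)).exists_lipschitzOnWith_of_compact hc
  exact hK.comp_absolutelyContinuousOnInterval hf

theorem AbsolutelyContinuousOnInterval.le_of_ae_deriv_nonpos {f : ℝ → ℝ} {a b : ℝ} (hab : a ≤ b)
    (hf : AbsolutelyContinuousOnInterval f a b)
    (h : ∀ᵐ t : ℝ, t ∈ Set.Ioc a b → deriv f t ≤ 0) : f b ≤ f a := by
  have h1 := hf.integral_deriv_eq_sub
  have h2 : ∫ t in a..b, deriv f t ≤ 0 := by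
    rw [intervalIntegral.integral_of_le hab]
    refine MeasureTheory.integral_nonpos_of_ae ?_
    rw [Filter.EventuallyLE, MeasureTheory.ae_restrict_iff' measurableSet_Ioc]
    exact h
  linarith

/-- Uniqueness of absolutely continuous solutions, from Grönwall's inequality: the weighted
square `exp (-Mt) ‖v t - v' t‖₂²` does not increase. -/
theorem AbsCont.eq_of_ae_deriv_dist_le {ι : Type*} [Fintype ι] {v v' : ℝ≥0 → ι → ℝ}
    (hv : AbsCont v) (hv' : AbsCont v') (h0 : v 0 = v' 0) (T : ℝ≥0) (K : ℝ)
    (h : ∀ᵐ t : ℝ, 0 < t → t ≤ T → ∃ w w', HasDerivAt (extendTime v) w t ∧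
      HasDerivAt (extendTime v') w' t ∧ ‖w - w'‖ ≤ K * ‖v t.toNNReal - v' t.toNNReal‖) :
    v T = v' T := by
  set d : ℝ → ι → ℝ := extendTime v - extendTime v' with hd
  have hdac : AbsolutelyContinuousOnInterval d 0 T := (hv T).sub (hv' T)
  set φ : (ι → ℝ) → ℝ := fun y => ∑ i, y i ^ 2 with hφ
  have hφc : ContDiff ℝ 1 φ := by fun_prop
  set M : ℝ := 2 * Fintype.card ι * K with hM
  set e : ℝ → ℝ := fun t => Real.exp (-(M * t)) with he
  have heac : AbsolutelyContinuousOnInterval e 0 T :=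
    ContDiffOn.absolutelyContinuousOnInterval (ContDiff.contDiffOn (by fun_prop))
  have hac := heac.mul (hφc.comp_absolutelyContinuousOnInterval hdac)
  have hle := hac.le_of_ae_deriv_nonpos T.2 (by
    filter_upwards [h] with t ht hmem
    obtain ⟨w, w', hw, hw', hww⟩ := ht hmem.1 hmem.2
    have hdt : HasDerivAt d (w - w') t := hw.sub hw'
    have hdi : ∀ i, HasDerivAt (fun s => d s i) ((w - w') i) t := hasDerivAt_pi.1 hdt
    have h1 : HasDerivAt (φ ∘ d) (∑ i, 2 * d t i * (w - w') i) t := by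
      have := HasDerivAt.fun_sum (u := Finset.univ) fun i _ => (hdi i).pow 2
      simpa [hφ, Function.comp_def] using this
    have h2 : HasDerivAt e (e t * -M) t := by
      have := ((hasDerivAt_id t).const_mul M).neg.exp
      simpa [he] using this
    rw [(h2.mul h1).deriv]
    have h3 : ∑ i, 2 * d t i * (w - w') i ≤ M * φ (d t) := by
      have hdn : v t.toNNReal - v' t.toNNReal = d t := rfl
      rw [hdn] at hww
      have hsq : ‖d t‖ ^ 2 ≤ φ (d t) := by
        have hφ0 : 0 ≤ φ (d t) := Finset.sum_nonneg fun i _ => sq_nonneg _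
        have hle : ‖d t‖ ≤ √(φ (d t)) := (pi_norm_le_iff_of_nonneg (Real.sqrt_nonneg _)).2
          fun i => Real.abs_le_sqrt (Finset.single_le_sum (f := fun i => d t i ^ 2)
            (fun j _ => sq_nonneg _) (Finset.mem_univ i))
        exact (Real.le_sqrt (norm_nonneg _) hφ0).1 hle
      have hK : ∀ i, 2 * d t i * (w - w') i ≤ 2 * (‖d t‖ * (K * ‖d t‖)) := by
        intro i
        have a1 : |d t i| ≤ ‖d t‖ := norm_le_pi_norm (d t) i
        have a2 : |(w - w') i| ≤ K * ‖d t‖ := (norm_le_pi_norm (w - w') i).trans hww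
        have a3 : d t i * (w - w') i ≤ |d t i| * |(w - w') i| := by
          rw [← abs_mul]; exact le_abs_self _
        have a4 := mul_le_mul a1 a2 (abs_nonneg _) (norm_nonneg _)
        linarith
      have hKd : ∑ i, 2 * d t i * (w - w') i ≤ M * ‖d t‖ ^ 2 := by
        refine (Finset.sum_le_sum fun i _ => hK i).trans (le_of_eq ?_)
        simp [hM]; ring
      rcases le_or_gt 0 K with hK0 | hK0
      · exact hKd.trans (mul_le_mul_of_nonneg_left hsq (by positivity))
      · have hz : d t = 0 := by
          by_contra hne
          have := norm_pos_iff.2 hne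
          nlinarith [norm_nonneg (w - w')]
        simp [hz, hφ]
    have h4 : 0 < e t := Real.exp_pos _
    simp only [Function.comp_apply]
    nlinarith)
  have hd0 : d 0 = 0 := by simp [hd, extendTime, h0]
  have hT : φ (d T) ≤ 0 := by
    have : 0 < e T := Real.exp_pos _
    simp only [Pi.mul_apply, Function.comp_apply, hd0] at hle
    have hφ0 : φ 0 = 0 := by simp [hφ]
    rw [hφ0, mul_zero] at hle
    exact le_of_not_gt fun hc => absurd (mul_pos this hc) (not_lt.2 hle)
  have hz : ∀ i, d T i = 0 := by
    intro i
    have h1 : φ (d T) = 0 := le_antisymm hT (Finset.sum_nonneg fun i _ => sq_nonneg _)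
    have := (Finset.sum_eq_zero_iff_of_nonneg fun i _ => sq_nonneg (d T i)).1 h1 i
      (Finset.mem_univ i)
    exact pow_eq_zero_iff (two_ne_zero) |>.1 this
  funext i
  have := hz i
  simp only [hd, extendTime, Pi.sub_apply, Real.toNNReal_coe] at this
  linarith

theorem AbsCont.continuous {X : Type*} [SeminormedAddCommGroup X] {x : ℝ≥0 → X} (hx : AbsCont x) :
    Continuous x := by
  rw [continuous_iff_continuousAt]
  intro t
  obtain ⟨T, hT⟩ := exists_gt t
  have h := (hx T).continuousOn
  rw [Set.uIcc_of_le T.coe_nonneg] at h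
  have h1 := h.continuousWithinAt (x := (t : ℝ)) 
    (Set.mem_Icc.2 ⟨t.coe_nonneg, NNReal.coe_le_coe.2 hT.le⟩)
  have h2 : Filter.Tendsto (fun s : ℝ≥0 => (s : ℝ)) (nhds t)
      (nhdsWithin (t : ℝ) (Set.Icc 0 T)) := by
    refine tendsto_nhdsWithin_iff.2 ⟨NNReal.continuous_coe.tendsto t, ?_⟩
    filter_upwards [Iio_mem_nhds hT] with s hs
    exact Set.mem_Icc.2 ⟨s.coe_nonneg, NNReal.coe_le_coe.2 (Set.mem_Iio.1 hs).le⟩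
  have h3 := h1.tendsto.comp h2
  simpa [ContinuousAt, extendTime, Function.comp_def] using h3

/-! ### Trajectories of recurrent neural networks -/

theorem PiecewiseConstant.ite_le {X : Type*} {u : ℝ≥0 → X} (hu : PiecewiseConstant u) (t : ℝ≥0)
    (α : X) : PiecewiseConstant fun s => if s ≤ t then u s else α := by
  obtain ⟨τ, h0, hmono, htop, hc⟩ := hu
  have hex : ∃ k, t ≤ τ k := (htop.eventually_ge_atTop t).exists
  classical
  -- The breakpoints before `t` are kept, and the others are replaced by `t, t + 1, t + 2, …`.
  set k := Nat.find hex with hk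
  have hkt : t ≤ τ k := Nat.find_spec hex
  have hlt : ∀ i, i < k → τ i < t := fun i hi => not_le.1 (Nat.find_min hex hi)
  refine ⟨fun i => if i < k then τ i else t + ((i - k : ℕ) : ℝ≥0), ?_, ?_, ?_, ?_⟩
  · by_cases h : 0 < k
    · simp [h, h0]
    · have hk0 : k = 0 := by omega
      rw [hk0, h0] at hkt
      simp [le_antisymm hkt bot_le, hk0]
  · refine strictMono_nat_of_lt_succ fun i => ?_
    by_cases h1 : i + 1 < k
    · simpa [h1, (Nat.lt_succ_self i).trans h1] using hmono (Nat.lt_succ_self i)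
    · by_cases h2 : i < k
      · have : i + 1 - k = 0 := by omega
        simpa [h1, h2, this] using hlt i h2
      · have : i + 1 - k = i - k + 1 := by omega
        simp [h1, h2, this]
  · have h1 : Filter.Tendsto (fun i : ℕ => ((i - k : ℕ) : ℝ≥0)) Filter.atTop Filter.atTop :=
      tendsto_natCast_atTop_atTop.comp (Filter.tendsto_sub_atTop_nat k)
    refine Filter.tendsto_atTop_mono' _ ?_ h1
    filter_upwards [Filter.eventually_ge_atTop k] with i hi
    simp [not_lt.2 hi]
  · intro i
    by_cases h1 : i + 1 < k
    · obtain ⟨a, ha⟩ := hc i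
      refine ⟨a, fun s hs => ?_⟩
      simp only [h1, (Nat.lt_succ_self i).trans h1, if_true] at hs
      exact (if_pos (hs.2.trans (hlt _ h1)).le).trans (ha s hs)
    · by_cases h2 : i < k
      · obtain ⟨a, ha⟩ := hc i
        refine ⟨a, fun s hs => ?_⟩
        have hik : i + 1 = k := by omega
        simp only [hik, h2, if_true, lt_irrefl, if_false, Nat.sub_self, Nat.cast_zero,
          add_zero] at hs
        exact (if_pos hs.2.le).trans (ha s ⟨hs.1, hik ▸ hs.2.trans_le hkt⟩)
      · refine ⟨α, fun s hs => ?_⟩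
        simp only [h2, if_false] at hs
        exact if_neg (not_le.2 (le_self_add.trans_lt hs.1))

/-- The input that follows `u` up to time `t` and is constant afterwards. -/
def PCInput.switch {𝒰 : Type*} (u : PCInput 𝒰) (t : ℝ≥0) (α : 𝒰) : PCInput 𝒰 :=
  ⟨fun s => if s ≤ t then u.1 s else α, u.2.ite_le t α⟩

namespace RNN

variable {σ : ℝ → ℝ} {m : ℕ} {𝒰 : Finset (Fin m → ℝ)} {q n : ℕ}

/-- The affine map `x ↦ A x + B α`, whose components are the arguments of `σ`. -/
def preact (S : RNN σ 𝒰 q n) (α : 𝒰) (x : Fin n → ℝ) : Fin n → ℝ :=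
  S.A.mulVec x + S.B.mulVec (α : Fin m → ℝ)

/-- The vector field `x ↦ σ(A x + B α)` of the network under the constant input `α`. -/
def field (S : RNN σ 𝒰 q n) (α : 𝒰) (x : Fin n → ℝ) : Fin n → ℝ :=
  fun j => σ (S.preact α x j)

theorem exists_norm_field_sub_le (S : RNN σ 𝒰 q n) :
    ∃ K : ℝ, ∀ α x y, ‖S.field α x - S.field α y‖ ≤ K * ‖x - y‖ := by
  obtain ⟨L, hL⟩ := S.lipschitz
  let f := LinearMap.toContinuousLinearMap S.A.mulVecLin
  refine ⟨L * ‖f‖, fun α x y => ?_⟩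
  refine (pi_norm_le_iff_of_nonneg (by positivity)).2 fun j => ?_
  have h1 := hL.dist_le_mul (S.preact α x j) (S.preact α y j)
  rw [Real.dist_eq, Real.dist_eq] at h1
  refine h1.trans ?_
  have h2 : S.preact α x j - S.preact α y j = f (x - y) j := by
    simp [preact, f, Matrix.mulVec_sub]
  have h3 : |f (x - y) j| ≤ ‖f‖ * ‖x - y‖ :=
    (norm_le_pi_norm (f (x - y)) j).trans (f.le_opNorm _)
  rw [h2, mul_assoc]
  exact mul_le_mul_of_nonneg_left h3 L.2

theorem continuous_field (S : RNN σ 𝒰 q n) (α : 𝒰) : Continuous (S.field α) := by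
  obtain ⟨L, hL⟩ := S.lipschitz
  refine continuous_pi fun j => hL.continuous.comp ?_
  unfold preact
  fun_prop

/-- Causality: the state at time `t` depends only on the input up to time `t`. -/
theorem IsSolution.eq_of_eq_input {S : RNN σ 𝒰 q n} {x x' : ℝ≥0 → Fin n → ℝ} {u u' : PCInput 𝒰}
    {y y' : ℝ≥0 → Fin q → ℝ} (h : S.IsSolution x u y) (h' : S.IsSolution x' u' y') {t : ℝ≥0}
    (hu : ∀ s ≤ t, u.1 s = u'.1 s) : x t = x' t := by
  obtain ⟨K, hK⟩ := S.exists_norm_field_sub_le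
  refine h.1.eq_of_ae_deriv_dist_le h'.1 (h.2.1.trans h'.2.1.symm) t K ?_
  filter_upwards [h.2.2.1, h'.2.2.1] with s hs hs' h0 hst
  refine ⟨_, _, hs h0, hs' h0, ?_⟩
  rw [hu _ (Real.toNNReal_le_iff_le_coe.2 hst)]
  exact hK _ _ _

/-- After switching to the constant input `α`, the trajectory leaves along the field of `α`. -/
theorem IsSolution.hasDerivWithinAt_switch {S : RNN σ 𝒰 q n} {x : ℝ≥0 → Fin n → ℝ}
    {u : PCInput 𝒰} {y : ℝ≥0 → Fin q → ℝ} {t : ℝ≥0} {α : 𝒰}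
    (h : S.IsSolution x (u.switch t α) y) :
    HasDerivWithinAt (extendTime x) (S.field α (x t)) (Set.Ici (t : ℝ)) t := by
  have hxc : Continuous (extendTime x) := h.1.continuous.comp continuous_real_toNNReal
  rw [hasDerivWithinAt_pi]
  intro j
  have hfc : Continuous fun s : ℝ => S.field α (extendTime x s) j :=
    (continuous_apply j).comp ((S.continuous_field α).comp hxc)
  have hxt : S.field α (x t) j = S.field α (extendTime x t) j := by simp [extendTime]
  have hint : ∀ s ∈ Set.Ici (t : ℝ), extendTime x s j =
      extendTime x t j + ∫ r in (t : ℝ)..s, S.field α (extendTime x r) j := by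
    intro s hs
    rw [Set.mem_Ici] at hs
    have hs0 : 0 ≤ s := t.coe_nonneg.trans hs
    have h1 : AbsolutelyContinuousOnInterval (fun r => extendTime x r j) t s := by
      have h2 := (LipschitzWith.eval (α := fun _ : Fin n => ℝ) j).lipschitzOnWith
        (s := extendTime x '' Set.uIcc 0 ((⟨s, hs0⟩ : ℝ≥0) : ℝ))
      refine (h2.comp_absolutelyContinuousOnInterval (h.1 ⟨s, hs0⟩)).mono ?_
      change Set.uIcc (t : ℝ) s ⊆ Set.uIcc 0 s
      rw [Set.uIcc_of_le hs, Set.uIcc_of_le hs0]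
      exact Set.Icc_subset_Icc_left t.coe_nonneg
    have h2 := h1.integral_deriv_eq_sub
    have h3 : ∫ r in (t : ℝ)..s, deriv (fun r => extendTime x r j) r =
        ∫ r in (t : ℝ)..s, S.field α (extendTime x r) j := by
      refine intervalIntegral.integral_congr_ae ?_
      filter_upwards [h.2.2.1] with r hr hmem
      rw [Set.uIoc_of_le hs] at hmem
      have hr0 : 0 < r := t.coe_nonneg.trans_lt hmem.1
      have hu : (u.switch t α).1 r.toNNReal = α := 
        if_neg (not_le.2 (Real.lt_toNNReal_iff_coe_lt.2 hmem.1))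
      have := (hasDerivAt_pi.1 (hr hr0) j).deriv
      rw [this, hu]
      rfl
    linarith
  have hder : HasDerivWithinAt (fun s => extendTime x t j +
      ∫ r in (t : ℝ)..s, S.field α (extendTime x r) j) (S.field α (extendTime x t) j)
      (Set.Ici (t : ℝ)) t :=
    ((intervalIntegral.integral_hasDerivAt_right (hfc.intervalIntegrable _ _)
      (hfc.stronglyMeasurableAtFilter _ _) hfc.continuousAt).const_add _).hasDerivWithinAt
  rw [hxt]
  exact hder.congr hint (hint _ Set.self_mem_Ici)

/-- The states `x` of `S` and `x'` of `S'` are reached at the same time under the same input. -/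
def Linked {n' : ℕ} (S : RNN σ 𝒰 q n) (S' : RNN σ 𝒰 q n') (f : IOMap 𝒰 q) (x : Fin n → ℝ)
    (x' : Fin n' → ℝ) : Prop :=
  ∃ u t ξ ξ', S.IsSolution ξ u (f u).1 ∧ S'.IsSolution ξ' u (f u).1 ∧ ξ t = x ∧ ξ' t = x'

/-- An identity between functions of the states of two realizations that holds at all pairs of
states reached simultaneously may be differentiated along each constant input: switch to that
input and take the right derivative. -/
theorem Linked.fderiv_eq {n' : ℕ} {S : RNN σ 𝒰 q n} {S' : RNN σ 𝒰 q n'} {f : IOMap 𝒰 q}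
    (hS : S.Realizes f) (hS' : S'.Realizes f) {G : (Fin n → ℝ) → ℝ} {G' : (Fin n' → ℝ) → ℝ}
    (hG : Differentiable ℝ G) (hG' : Differentiable ℝ G')
    (h : ∀ x x', S.Linked S' f x x' → G x = G' x') (α : 𝒰) {x : Fin n → ℝ} {x' : Fin n' → ℝ}
    (hl : S.Linked S' f x x') :
    fderiv ℝ G x (S.field α x) = fderiv ℝ G' x' (S'.field α x') := by
  obtain ⟨u, t, ξ, ξ', hξ, hξ', rfl, rfl⟩ := hl
  obtain ⟨ζ, hζ⟩ := hS (u.switch t α)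
  obtain ⟨ζ', hζ'⟩ := hS' (u.switch t α)
  have hu : ∀ s ≤ t, u.1 s = (u.switch t α).1 s := fun s hs => (if_pos hs).symm
  rw [hξ.eq_of_eq_input hζ hu, hξ'.eq_of_eq_input hζ' hu]
  have e : extendTime ζ t = ζ t := by simp [extendTime]
  have e' : extendTime ζ' t = ζ' t := by simp [extendTime]
  have d := (e ▸ (hG (ζ t)).hasFDerivAt).comp_hasDerivWithinAt (t : ℝ) hζ.hasDerivWithinAt_switch
  have d' := (e' ▸ (hG' (ζ' t)).hasFDerivAt).comp_hasDerivWithinAt (t : ℝ)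
    hζ'.hasDerivWithinAt_switch
  have hfun : G ∘ extendTime ζ = G' ∘ extendTime ζ' := funext fun s =>
    h _ _ ⟨_, s.toNNReal, ζ, ζ', hζ, hζ', rfl, rfl⟩
  rw [hfun] at d
  have := (uniqueDiffOn_Ici (t : ℝ) t Set.self_mem_Ici).eq_deriv _ d d'
  simpa [e, e'] using this

end RNN

/-! ### Fractions in a domain, derivations and transcendence degree -/

section FracClosure

variable {k K : Type*} [Field k] [CommRing K] [IsDomain K] [Algebra k K]

/-- The elements of the domain `K` that are fractions of elements of the subalgebra generated
by `s`: the intersection of `K` with the field `k(s)`. -/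
def fracClosure (k : Type*) {K : Type*} [Field k] [CommRing K] [IsDomain K] [Algebra k K]
    (s : Set K) : Subalgebra k K where
  carrier := {x | ∃ b ∈ Algebra.adjoin k s, b ≠ 0 ∧ b * x ∈ Algebra.adjoin k s}
  mul_mem' := by
    rintro x y ⟨b, hb, hb0, hx⟩ ⟨c, hc, hc0, hy⟩
    refine ⟨b * c, mul_mem hb hc, mul_ne_zero hb0 hc0, ?_⟩
    rw [mul_mul_mul_comm]
    exact mul_mem hx hy
  add_mem' := by
    rintro x y ⟨b, hb, hb0, hx⟩ ⟨c, hc, hc0, hy⟩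
    refine ⟨b * c, mul_mem hb hc, mul_ne_zero hb0 hc0, ?_⟩
    have : b * c * (x + y) = c * (b * x) + b * (c * y) := by ring
    rw [this]
    exact add_mem (mul_mem hc hx) (mul_mem hb hy)
  algebraMap_mem' r := ⟨1, one_mem _, one_ne_zero, by
    rw [one_mul]; exact Subalgebra.algebraMap_mem _ r⟩

theorem adjoin_le_fracClosure (s : Set K) : Algebra.adjoin k s ≤ fracClosure k s :=
  fun x hx => ⟨1, one_mem _, one_ne_zero, by rwa [one_mul]⟩

theorem mem_fracClosure_of_mul_mem {s : Set K} {b x : K} (hb : b ∈ fracClosure k s) (hb0 : b ≠ 0)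
    (hx : b * x ∈ fracClosure k s) : x ∈ fracClosure k s := by
  obtain ⟨c, hc, hc0, hcb⟩ := hb
  obtain ⟨d, hd, hd0, hdx⟩ := hx
  refine ⟨d * (c * b), mul_mem hd hcb, mul_ne_zero hd0 (mul_ne_zero hc0 hb0), ?_⟩
  have : d * (c * b) * x = c * (d * (b * x)) := by ring
  rw [this]
  exact mul_mem hc hdx

theorem derivation_mem_fracClosure {s : Set K} (D : Derivation k K K)
    (h : ∀ x ∈ s, D x ∈ fracClosure k s) {x : K} (hx : x ∈ fracClosure k s) :
    D x ∈ fracClosure k s := by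
  have key : ∀ y ∈ Algebra.adjoin k s, D y ∈ fracClosure k s := by
    intro y hy
    induction hy using Algebra.adjoin_induction with
    | mem y hy => exact h y hy
    | algebraMap r => simp
    | add y z _ _ hy hz => rw [map_add]; exact add_mem hy hz
    | mul y z hy0 hz0 hy hz =>
      rw [D.leibniz]
      exact add_mem (mul_mem (adjoin_le_fracClosure s hy0) hz)
        (mul_mem (adjoin_le_fracClosure s hz0) hy)
  have hx0 := hx
  obtain ⟨b, hb, hb0, hbx⟩ := hx
  refine mem_fracClosure_of_mul_mem (adjoin_le_fracClosure s hb) hb0 ?_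
  have h1 : b * D x = D (b * x) - x * D b := by
    rw [D.leibniz, smul_eq_mul, smul_eq_mul]; ring
  rw [h1]
  exact sub_mem (key _ hbx) (mul_mem hx0 (key _ hb))

theorem trdeg_fracClosure_le (s : Set K) : Algebra.trdeg k (fracClosure k s) ≤ Cardinal.mk s := by
  set s' : Set (fracClosure k s) := Subtype.val ⁻¹' s with hs'
  have hlift : ∀ y ∈ Algebra.adjoin k s, ∃ z ∈ Algebra.adjoin k s', (z : K) = y := by
    intro y hy
    have himg : (fracClosure k s).val '' s' = s := by
      rw [hs']
      refine Set.image_preimage_eq_of_subset fun x hx => ?_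
      exact ⟨⟨x, adjoin_le_fracClosure s (Algebra.subset_adjoin hx)⟩, rfl⟩
    have h1 : Algebra.adjoin k s = (Algebra.adjoin k s').map (fracClosure k s).val := by
      rw [AlgHom.map_adjoin, himg]
    rw [h1] at hy
    exact hy
  have halg : Algebra.IsAlgebraic (Algebra.adjoin k s') (fracClosure k s) := by
    refine ⟨fun x => ?_⟩
    obtain ⟨b, hb, hb0, hbx⟩ := x.2
    obtain ⟨b', hb', hbe⟩ := hlift b hb
    obtain ⟨c', hc', hce⟩ := hlift _ hbx
    refine ⟨Polynomial.C ⟨b', hb'⟩ * Polynomial.X - Polynomial.C ⟨c', hc'⟩, fun h0 => ?_, ?_⟩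
    · have h1 := congrArg (fun P => Polynomial.coeff P 1) h0
      simp only [Polynomial.coeff_sub, Polynomial.coeff_C_mul, Polynomial.coeff_X_one, mul_one,
        Polynomial.coeff_zero, Polynomial.coeff_C_succ, sub_zero] at h1
      exact hb0 (hbe.symm.trans (congrArg (fun z => ((z : fracClosure k s) : K))
        (congrArg Subtype.val h1)))
    · apply Subtype.ext
      have h1 : ((b' * x - c' : fracClosure k s) : K) = 0 := by
        push_cast
        rw [hbe, hce, sub_self]
      simpa [Algebra.algebraMap_eq_smul_one, Subalgebra.smul_def] using h1
  refine (Algebra.IsAlgebraic.trdeg_le_cardinalMk k s').trans ?_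
  exact Cardinal.mk_preimage_of_injective _ _ Subtype.val_injective

end FracClosure

theorem Derivation.map_aeval_mvPolynomial {k K ι : Type*} [CommRing k] [CommRing K] [Algebra k K]
    [Fintype ι] (D : Derivation k K K) (v : ι → K) (a : MvPolynomial ι k) :
    D (MvPolynomial.aeval v a) =
      ∑ i, MvPolynomial.aeval v (MvPolynomial.pderiv i a) * D (v i) := by
  classical
  induction a using MvPolynomial.induction_on with
  | C r => simp
  | add p q hp hq => simp [hp, hq, add_mul, Finset.sum_add_distrib]
  | mul_X p i hp =>
    have h1 : ∀ j, MvPolynomial.aeval v (MvPolynomial.pderiv j (p * MvPolynomial.X i)) * D (v j) =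
        v i * (MvPolynomial.aeval v (MvPolynomial.pderiv j p) * D (v j)) +
          if i = j then MvPolynomial.aeval v p * D (v j) else 0 := by
      intro j
      rw [Derivation.leibniz, MvPolynomial.pderiv_X]
      by_cases h : i = j
      · subst h; simp; ring
      · simp [h]; ring
    simp only [h1, Finset.sum_add_distrib, ← Finset.mul_sum, ← hp]
    simp [add_comm]

/-! ### The domain of analytic functions -/

section Analytic

variable (E : Type*) [NormedAddCommGroup E] [NormedSpace ℝ E]

/-- The algebra of real analytic functions on `E`. -/
def analyticAlgebra : Subalgebra ℝ (E → ℝ) where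
  carrier := {f | AnalyticOnNhd ℝ f Set.univ}
  mul_mem' hf hg := hf.mul hg
  add_mem' hf hg := hf.add hg
  algebraMap_mem' _ := analyticOnNhd_const

variable {E}

theorem analyticAlgebra.differentiable (f : analyticAlgebra E) : Differentiable ℝ f.1 :=
  fun x => (f.2 x trivial).differentiableAt

theorem analyticAlgebra.eval_aeval {ι : Type*} (v : ι → analyticAlgebra E)
    (a : MvPolynomial ι ℝ) (x : E) :
    (MvPolynomial.aeval v a).1 x = MvPolynomial.eval (fun i => (v i).1 x) a := by
  induction a using MvPolynomial.induction_on with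
  | C r => simp
  | add p q hp hq => simp [← hp, ← hq]
  | mul_X p i hp => simp [← hp]

/-- By the identity principle, an analytic function that vanishes on a non-empty open set is
zero; and the first of two functions with product zero vanishes where the second does not. -/
instance : IsDomain (analyticAlgebra E) := by
  have : NoZeroDivisors (analyticAlgebra E) := ⟨by
    intro f g hfg
    by_contra! h
    obtain ⟨x, hx⟩ : ∃ x, g.1 x ≠ 0 := by
      by_contra! hg
      exact h.2 (Subtype.ext (funext hg))
    have hev : f.1 =ᶠ[nhds x] 0 := by
      filter_upwards [((analyticAlgebra.differentiable g).continuous.continuousAt (x := x)).eventually_ne hx]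
        with y hy
      exact (mul_eq_zero.1 (congrFun (congrArg Subtype.val hfg) y)).resolve_right hy
    exact h.1 (Subtype.ext (funext fun y =>
      f.2.eqOn_of_preconnected_of_eventuallyEq (g := 0) analyticOnNhd_const isPreconnected_univ
        (Set.mem_univ x) hev (Set.mem_univ y)))⟩
  have : Nontrivial (analyticAlgebra E) := ⟨0, 1, fun h => by
    simpa using congrFun (congrArg Subtype.val h) 0⟩
  exact NoZeroDivisors.to_isDomain _

/-- The derivative of analytic functions along an analytic vector field. -/
def dirDeriv (F : E → E) (hF : AnalyticOnNhd ℝ F Set.univ) :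
    Derivation ℝ (analyticAlgebra E) (analyticAlgebra E) where
  toFun f := ⟨fun x => fderiv ℝ f.1 x (F x), fun x hx => 
    ((ContinuousLinearMap.id ℝ (E →L[ℝ] ℝ)).analyticAt_bilinear _).comp₂ (f.2 x hx).fderiv (hF x hx)⟩
  map_add' f g := Subtype.ext (funext fun x => by
    have := fderiv_add (analyticAlgebra.differentiable f x) (analyticAlgebra.differentiable g x)
    simp [this])
  map_smul' c f := Subtype.ext (funext fun x => by
    have := fderiv_const_smul (analyticAlgebra.differentiable f x) c
    simp [this])
  map_one_eq_zero' := Subtype.ext (funext fun x => by simp)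
  leibniz' f g := Subtype.ext (funext fun x => by
    have := fderiv_mul (analyticAlgebra.differentiable f x) (analyticAlgebra.differentiable g x)
    simp [this])

end Analytic

/-! ### Realizing rational functions by elements of an algebra -/

section RatRel

open MvPolynomial

variable {ι : Type} {K : Type*} [CommRing K] [Algebra ℝ K]

theorem toRatFun_ne_zero {a : MvPolynomial ι ℝ} (ha : a ≠ 0) : toRatFun a ≠ 0 := fun h =>
  ha (toRatFun_injective (by rw [h, map_zero]))

/-- The pairs `(g, G)` such that `g = a / b` with `b ≠ 0` and `b(v) G = a(v)`. The element `b(v)`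
may be zero or a zero divisor, so `G` need not be determined by `g`. -/
def ratRel (v : ι → K) : Subalgebra ℝ (RatFun ι × K) where
  carrier := {p | ∃ a b : MvPolynomial ι ℝ, b ≠ 0 ∧ toRatFun b * p.1 = toRatFun a ∧
    aeval v b * p.2 = aeval v a}
  mul_mem' := by
    rintro ⟨g, G⟩ ⟨h, H⟩ ⟨a, b, hb, h1, h2⟩ ⟨c, d, hd, h3, h4⟩
    refine ⟨a * c, b * d, mul_ne_zero hb hd, ?_, ?_⟩
    · simp only [map_mul, Prod.mk_mul_mk] at *
      rw [← h1, ← h3]; ring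
    · simp only [map_mul, Prod.mk_mul_mk] at *
      rw [← h2, ← h4]; ring
  add_mem' := by
    rintro ⟨g, G⟩ ⟨h, H⟩ ⟨a, b, hb, h1, h2⟩ ⟨c, d, hd, h3, h4⟩
    refine ⟨a * d + b * c, b * d, mul_ne_zero hb hd, ?_, ?_⟩
    · simp only [map_mul, map_add, Prod.mk_add_mk] at *
      rw [← h1, ← h3]; ring
    · simp only [map_mul, map_add, Prod.mk_add_mk] at *
      rw [← h2, ← h4]; ring
  algebraMap_mem' r := ⟨C r, 1, one_ne_zero, by
    rw [← algebraMap_eq, AlgHom.commutes, map_one, one_mul]; rfl, by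
    rw [← algebraMap_eq, AlgHom.commutes, map_one, one_mul]; rfl⟩

/-- A derivation of `K` that acts on the `v i` as the vector field of a rational system
prescribes acts on the realizations of rational functions as the Lie derivative. -/
theorem RationalSystem.lieDeriv_mem_ratRel {𝒰 κ : Type} [Fintype ι] (R : RationalSystem 𝒰 ι κ)
    (α : 𝒰) {v : ι → K} (D : Derivation ℝ K K)
    (hD : ∀ i, aeval v (R.Q α i) * D (v i) = aeval v (R.P α i)) {g : RatFun ι} {G : K}
    (h : (g, G) ∈ ratRel v) : (R.lieDeriv α g, D G) ∈ ratRel v := by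
  classical
  obtain ⟨a, b, hb, h1, h2⟩ := h
  simp only at h1 h2
  have hb' := toRatFun_ne_zero hb
  have hg : g = toRatFun a / toRatFun b := by
    rw [eq_div_iff hb', mul_comm, h1]
  have hW : ∀ i, ∏ r, R.Q α r = R.Q α i * ∏ r ∈ Finset.univ.erase i, R.Q α r := fun i =>
    (Finset.mul_prod_erase _ _ (Finset.mem_univ i)).symm
  refine ⟨∑ i, R.P α i * (∏ r ∈ Finset.univ.erase i, R.Q α r) *
      (pderiv i a * b - a * pderiv i b), (∏ i, R.Q α i) * b ^ 2,
    mul_ne_zero (Finset.prod_ne_zero_iff.2 fun i _ => R.Q_ne_zero α i) (pow_ne_zero 2 hb), ?_, ?_⟩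
  · simp only [RationalSystem.lieDeriv, hg, ratPDeriv_div _ _ _ hb]
    rw [Finset.mul_sum, map_sum]
    refine Finset.sum_congr rfl fun i _ => ?_
    have hQ := toRatFun_ne_zero (R.Q_ne_zero α i)
    rw [hW i]
    simp only [map_mul, map_pow]
    field_simp
  · have e : aeval v b ^ 2 * D G = aeval v b * D (aeval v a) - aeval v a * D (aeval v b) := by
      rw [← h2, D.leibniz, smul_eq_mul, smul_eq_mul]; ring
    rw [map_mul, map_pow, mul_assoc, e, D.map_aeval_mvPolynomial, D.map_aeval_mvPolynomial,
      Finset.mul_sum, Finset.mul_sum, ← Finset.sum_sub_distrib, Finset.mul_sum, map_sum]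
    refine Finset.sum_congr rfl fun i _ => ?_
    rw [hW i]
    simp only [map_mul, map_sub, ← hD i]
    ring

end RatRel

/-! ### The auxiliary system along trajectories of the network -/

namespace RNN

open MvPolynomial

variable {σ : ℝ → ℝ} {m : ℕ} {𝒰 : Finset (Fin m → ℝ)} {q n : ℕ}

theorem hasFDerivAt_preact (S : RNN σ 𝒰 q n) (α : 𝒰) (x : Fin n → ℝ) (j : Fin n) :
    HasFDerivAt (fun y => S.preact α y j)
      ((ContinuousLinearMap.proj (R := ℝ) (φ := fun _ : Fin n => ℝ) j).comp
        (LinearMap.toContinuousLinearMap S.A.mulVecLin)) x := by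
  have := ((ContinuousLinearMap.proj (R := ℝ) (φ := fun _ : Fin n => ℝ) j).comp
    (LinearMap.toContinuousLinearMap S.A.mulVecLin)).hasFDerivAt (x := x)
  simpa [preact] using this.add_const (S.B.mulVec (α : Fin m → ℝ) j)

/-- The analytic function `x ↦ f((A x + B α)_j)` of the state of the network. -/
def compPreact (S : RNN σ 𝒰 q n) {f : ℝ → ℝ} (hf : ∀ s, AnalyticAt ℝ f s) (j : Fin n) (α : 𝒰) :
    analyticAlgebra (Fin n → ℝ) :=
  ⟨fun x => f (S.preact α x j), fun x _ => by
    have h : AnalyticAt ℝ (fun y => S.preact α y j) x := by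
      have := (((ContinuousLinearMap.proj (R := ℝ) (φ := fun _ : Fin n => ℝ) j).comp
        (LinearMap.toContinuousLinearMap S.A.mulVecLin)).analyticAt x).add
        (analyticAt_const (v := S.B.mulVec (α : Fin m → ℝ) j))
      exact this
    exact (hf _).comp h⟩

theorem compPreact_apply (S : RNN σ 𝒰 q n) {f : ℝ → ℝ} (hf : ∀ s, AnalyticAt ℝ f s) (j : Fin n)
    (α : 𝒰) (x : Fin n → ℝ) : (S.compPreact hf j α).1 x = f (S.preact α x j) := rfl

variable (D : ActivationData σ)

/-- The Lie derivative of analytic functions along the field of the network. -/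
def lie (S : RNN σ 𝒰 q n) (β : 𝒰) :
    Derivation ℝ (analyticAlgebra (Fin n → ℝ)) (analyticAlgebra (Fin n → ℝ)) :=
  dirDeriv (S.field β) fun x _ => AnalyticAt.pi fun j => (S.compPreact D.σ_analytic j β).2 x trivial

theorem lie_apply (S : RNN σ 𝒰 q n) (β : 𝒰) (f : analyticAlgebra (Fin n → ℝ)) (x : Fin n → ℝ) :
    (S.lie D β f).1 x = fderiv ℝ f.1 x (S.field β x) := rfl

theorem lie_compPreact (S : RNN σ 𝒰 q n) {f : ℝ → ℝ} (hf : ∀ s, AnalyticAt ℝ f s)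
    (hf' : ∀ s, AnalyticAt ℝ (deriv f) s) (j : Fin n) (α β : 𝒰) :
    S.lie D β (S.compPreact hf j α) =
      S.compPreact hf' j α * ∑ l, S.A j l • S.compPreact D.σ_analytic l β := by
  refine Subtype.ext (funext fun x => ?_)
  rw [lie_apply]
  have h := ((hf (S.preact α x j)).differentiableAt.hasDerivAt).comp_hasFDerivAt x
    (S.hasFDerivAt_preact α x j)
  have h1 : fderiv ℝ (S.compPreact hf j α).1 x = _ := h.fderiv
  rw [h1]
  simp [field, compPreact_apply, Matrix.mulVec, dotProduct]

/-- The states `v_{i,j,α} = ξ_i((A x + B α)_j)` of the auxiliary system as functions of the state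
`x` of the network. -/
def auxState (S : RNN σ 𝒰 q n) (p : Fin D.N × Fin n × 𝒰) : analyticAlgebra (Fin n → ℝ) :=
  S.compPreact (D.ξ_analytic p.1) p.2.1 p.2.2

/-- The point of the state space of the auxiliary system given by the state `x`. -/
def auxPoint (S : RNN σ 𝒰 q n) (x : Fin n → ℝ) (p : Fin D.N × Fin n × 𝒰) : ℝ :=
  D.ξ p.1 (S.preact p.2.2 x p.2.1)

theorem aeval_auxState_apply (S : RNN σ 𝒰 q n) (a : MvPolynomial (Fin D.N × Fin n × 𝒰) ℝ)
    (x : Fin n → ℝ) : (aeval (S.auxState D) a).1 x = eval (S.auxPoint D x) a :=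
  analyticAlgebra.eval_aeval _ a x

theorem eval_auxPoint_blockVar (S : RNN σ 𝒰 q n) (x : Fin n → ℝ) (j : Fin n) (α : 𝒰)
    (g : MvPolynomial (Fin D.N) ℝ) :
    eval (S.auxPoint D x) (blockVar j α g) = eval (fun i => D.ξ i (S.preact α x j)) g := by
  simp only [blockVar, eval_rename]
  rfl

/-- A linear combination of quotients `s_l = U_l / V_l`, brought to the common denominator. -/
theorem _root_.sum_mul_prod_eq {ι R : Type*} [Fintype ι] [DecidableEq ι] [CommRing R]
    (c s U V : ι → R) (h : ∀ l, s l * V l = U l) :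
    (∏ r, V r) * ∑ l, c l * s l = ∑ l, c l * U l * ∏ r ∈ Finset.univ.erase l, V r := by
  rw [Finset.mul_sum]
  refine Finset.sum_congr rfl fun l _ => ?_
  rw [← Finset.mul_prod_erase _ _ (Finset.mem_univ l), ← h l]
  ring

theorem eval_Q_mul_lie (S : RNN σ 𝒰 q n) (β : 𝒰) (p : Fin D.N × Fin n × 𝒰) (x : Fin n → ℝ) :
    eval (S.auxPoint D x) ((S.auxSystem D).Q β p) * (S.lie D β (S.auxState D p)).1 x =
      eval (S.auxPoint D x) ((S.auxSystem D).P β p) := by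
  obtain ⟨i, j, α⟩ := p
  rw [auxState, lie_compPreact D S _ (fun s => (D.ξ_analytic i s).deriv)]
  have h1 := sum_mul_prod_eq (fun l => S.A j l) (fun l => σ (S.preact β x l)) _ _
    (fun l => D.σ_eq (S.preact β x l))
  have h2 := D.ξ_eq i (S.preact α x j)
  simp only [auxSystem, map_mul, map_prod, map_sum, eval_auxPoint_blockVar, eval_C]
  rw [← h1, ← h2]
  simp [compPreact_apply]
  ring

theorem aeval_Q_mul_lie (S : RNN σ 𝒰 q n) (β : 𝒰) (p : Fin D.N × Fin n × 𝒰) :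
    aeval (S.auxState D) ((S.auxSystem D).Q β p) * S.lie D β (S.auxState D p) =
      aeval (S.auxState D) ((S.auxSystem D).P β p) := by
  refine Subtype.ext (funext fun x => ?_)
  have := S.eval_Q_mul_lie D β p x
  rw [← aeval_auxState_apply, ← aeval_auxState_apply] at this
  exact this

theorem eval_h₂_mul (S : RNN σ 𝒰 q n) (k : Fin q) (α : 𝒰) (x : Fin n → ℝ) :
    eval (S.auxPoint D x) ((S.auxSystem D).h₂ (k, α)) * ∑ l, S.C k l * S.field α x l =
      eval (S.auxPoint D x) ((S.auxSystem D).h₁ (k, α)) := by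
  simp only [auxSystem, map_mul, map_prod, map_sum, eval_auxPoint_blockVar, eval_C]
  exact sum_mul_prod_eq (fun l => S.C k l) (fun l => σ (S.preact α x l)) _ _
    (fun l => D.σ_eq (S.preact α x l))

theorem _root_.Continuous.piecewiseContinuous {X : Type*} [TopologicalSpace X] {y : ℝ≥0 → X}
    (hy : Continuous y) : PiecewiseContinuous y :=
  ⟨fun k => k, Nat.cast_zero, Nat.strictMono_cast, tendsto_natCast_atTop_atTop, fun _ =>
    ⟨hy.continuousOn, ⟨_, hy.continuousAt.tendsto.mono_left nhdsWithin_le_nhds⟩,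
      ⟨_, hy.continuousAt.tendsto.mono_left nhdsWithin_le_nhds⟩⟩⟩

/-- Every trajectory of the network yields a trajectory of the auxiliary system. -/
theorem IsSolution.exists_auxSystem_isSolution {S : RNN σ 𝒰 q n} {x : ℝ≥0 → Fin n → ℝ}
    {u : PCInput 𝒰} {y : ℝ≥0 → Fin q → ℝ} (h : S.IsSolution x u y) :
    ∃ y', (S.auxSystem D).IsSolution (fun t => S.auxPoint D (x t)) u y' := by
  have hy : Continuous fun (t : ℝ≥0) (p : Fin q × 𝒰) =>
      ∑ l, S.C p.1 l * S.field p.2 (x t) l := by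
    refine continuous_pi fun p => continuous_finsetSum _ fun l _ => continuous_const.mul ?_
    exact (continuous_apply l).comp ((S.continuous_field p.2).comp h.1.continuous)
  refine ⟨⟨_, hy.piecewiseContinuous⟩, ?_, ?_, ?_⟩
  · have hc : ContDiff ℝ 1 (S.auxPoint D) := contDiff_pi.2 fun p =>
      contDiff_iff_contDiffAt.2 fun z => ((S.auxState D p).2 z trivial).contDiffAt
    exact fun T => hc.comp_absolutelyContinuousOnInterval (h.1 T)
  · filter_upwards [h.2.2.1] with t ht h0
    refine ⟨fun p => (S.lie D (u.1 t.toNNReal) (S.auxState D p)).1 (x t.toNNReal), ?_, fun p => ?_⟩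
    · refine hasDerivAt_pi.2 fun p => ?_
      exact ((analyticAlgebra.differentiable (S.auxState D p)) _).hasFDerivAt.comp_hasDerivAt t
        (ht h0)
    · rw [mul_comm]
      exact S.eval_Q_mul_lie D _ p _
  · intro t p
    rw [mul_comm]
    exact S.eval_h₂_mul D p.1 p.2 (x t)

theorem exists_linked_of_mem_reachableSet {n' : ℕ} {S : RNN σ 𝒰 q n} {S' : RNN σ 𝒰 q n'}
    {f : IOMap 𝒰 q} (hS : S.Realizes f) (hS' : S'.Realizes f)
    (huniq : (S.auxSystem D).HasUniqueTrajectories) {z : Fin D.N × Fin n × 𝒰 → ℝ}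
    (hz : z ∈ (S.auxSystem D).reachableSet) :
    ∃ x x', S.Linked S' f x x' ∧ S.auxPoint D x = z := by
  obtain ⟨v, u, y, t, hv, hv0, rfl⟩ := hz
  obtain ⟨ξ, hξ⟩ := hS u
  obtain ⟨ξ', hξ'⟩ := hS' u
  obtain ⟨y', hy'⟩ := hξ.exists_auxSystem_isSolution D
  have h0 : S.auxPoint D (ξ 0) = (S.auxSystem D).v₀ := by
    rw [hξ.2.1]; rfl
  have := huniq u v _ y y' hv hy' hv0 h0
  exact ⟨ξ t, ξ' t, ⟨u, t, ξ, ξ', hξ, hξ', rfl, rfl⟩, by rw [this]⟩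

end RNN

theorem RationalSystem.AlgebraicallyReachable.reachableSet_nonempty {𝒰 ι κ : Type} [Fintype ι]
    {R : RationalSystem 𝒰 ι κ} (hR : R.AlgebraicallyReachable) : R.reachableSet.Nonempty := by
  by_contra hne
  rw [Set.not_nonempty_iff_eq_empty] at hne
  exact one_ne_zero (hR 1 (by simp [hne]))

/-! ### The functions generated by a network and their transcendence degree -/

namespace RNN

open MvPolynomial

variable {σ : ℝ → ℝ} {m : ℕ} {𝒰 : Finset (Fin m → ℝ)} {q n : ℕ} (D : ActivationData σ)

/-- The analytic functions of the state of the network that are fractions of polynomials in the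
states of the auxiliary system. -/
def auxFrac (S : RNN σ 𝒰 q n) : Subalgebra ℝ (analyticAlgebra (Fin n → ℝ)) :=
  fracClosure ℝ (Set.range (S.auxState D))

/-- If `f V(ξ) = U(ξ)` with `V(ξ)` not identically zero, then `f((A x + B α)_j)` is a fraction of
polynomials in the auxiliary states. -/
theorem compPreact_mem_auxFrac (S : RNN σ 𝒰 q n) {f : ℝ → ℝ} (hf : ∀ s, AnalyticAt ℝ f s)
    {U V : MvPolynomial (Fin D.N) ℝ}
    (h : ∀ s, f s * eval (fun l => D.ξ l s) V = eval (fun l => D.ξ l s) U)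
    (hV : ∃ s, eval (fun l => D.ξ l s) V ≠ 0) (j : Fin n) (α : 𝒰) :
    S.compPreact hf j α ∈ S.auxFrac D := by
  by_cases hA : ∀ l, S.A j l = 0
  · -- If `(A x + B α)_j` does not depend on `x`, the denominator `V(ξ)` may vanish at its value,
    -- but then the function is constant.
    have : S.compPreact hf j α = algebraMap ℝ _ (f (S.preact α 0 j)) := by
      refine Subtype.ext (funext fun x => ?_)
      have hx : S.preact α x j = S.preact α 0 j := by
        simp [preact, Matrix.mulVec, dotProduct, hA]
      rw [compPreact_apply, hx]
      rfl
    rw [this]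
    exact Subalgebra.algebraMap_mem _ _
  · push Not at hA
    obtain ⟨l, hl⟩ := hA
    obtain ⟨s, hs⟩ := hV
    have hmem : ∀ a : MvPolynomial (Fin D.N × Fin n × 𝒰) ℝ,
        aeval (S.auxState D) a ∈ Algebra.adjoin ℝ (Set.range (S.auxState D)) := by
      intro a
      rw [Algebra.adjoin_range_eq_range_aeval]
      exact ⟨a, rfl⟩
    refine ⟨aeval (S.auxState D) (blockVar j α V), hmem _, fun h0 => hs ?_, ?_⟩
    · have h1 := congrFun (congrArg Subtype.val h0)
        (Pi.single l ((s - S.B.mulVec (α : Fin m → ℝ) j) / S.A j l))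
      rw [aeval_auxState_apply, eval_auxPoint_blockVar] at h1
      have h2 : S.preact α (Pi.single l ((s - S.B.mulVec (α : Fin m → ℝ) j) / S.A j l)) j = s := by
        simp only [preact, Pi.add_apply, Matrix.mulVec_single, Pi.smul_apply,
          Matrix.col_apply, op_smul_eq_mul]
        field_simp
        ring
      rw [h2] at h1
      exact h1
    · have : aeval (S.auxState D) (blockVar j α V) * S.compPreact hf j α =
          aeval (S.auxState D) (blockVar j α U) := by
        refine Subtype.ext (funext fun x => ?_)
        rw [aeval_auxState_apply, eval_auxPoint_blockVar, ← h, mul_comm,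
          ← eval_auxPoint_blockVar, ← aeval_auxState_apply]
        rfl
      rw [this]
      exact hmem _

theorem lie_mem_auxFrac (S : RNN σ 𝒰 q n)
    (hV₀ : ∃ s, eval (fun l => D.ξ l s) D.V₀ ≠ 0)
    (hV : ∀ i, ∃ s, eval (fun l => D.ξ l s) (D.V i) ≠ 0) (β : 𝒰)
    {g : analyticAlgebra (Fin n → ℝ)} (hg : g ∈ S.auxFrac D) : S.lie D β g ∈ S.auxFrac D := by
  refine derivation_mem_fracClosure _ ?_ hg
  rintro _ ⟨⟨i, j, α⟩, rfl⟩
  rw [auxState, lie_compPreact D S _ (fun s => (D.ξ_analytic i s).deriv)]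
  refine mul_mem (S.compPreact_mem_auxFrac D _ (D.ξ_eq i) (hV i) j α) (sum_mem fun l _ => ?_)
  exact Subalgebra.smul_mem _ (S.compPreact_mem_auxFrac D _ D.σ_eq hV₀ l β) _

theorem trdeg_auxFrac_le (S : RNN σ 𝒰 q n) :
    Algebra.trdeg ℝ (S.auxFrac D) ≤ (D.N * (n * 𝒰.card) : ℕ) := by
  refine (trdeg_fracClosure_le _).trans (Cardinal.mk_range_le.trans (le_of_eq ?_))
  simp

/-! ### Comparison of two realizations -/

section Comparison

variable {n' : ℕ} (S : RNN σ 𝒰 q n) (S' : RNN σ 𝒰 q n') (f : IOMap 𝒰 q)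

/-- The pairs of a rational function `g` of the auxiliary states of `S` and of a function `G'` of
the state of `S'` for which a function `G` of the state of `S` realizes `g` and takes the same
values as `G'` along all pairs of trajectories with the same input. -/
def commonObs : Subalgebra ℝ (RatFun (Fin D.N × Fin n × 𝒰) × analyticAlgebra (Fin n' → ℝ)) where
  carrier := {p | p.2 ∈ S'.auxFrac D ∧ ∃ G, (p.1, G) ∈ ratRel (S.auxState D) ∧
    ∀ x x', S.Linked S' f x x' → G.1 x = p.2.1 x'}
  mul_mem' := by
    rintro a b ⟨ha, G, hG, h1⟩ ⟨hb, H, hH, h2⟩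
    refine ⟨mul_mem ha hb, G * H, mul_mem hG hH, fun x x' hl => ?_⟩
    exact congrArg₂ (· * ·) (h1 x x' hl) (h2 x x' hl)
  add_mem' := by
    rintro a b ⟨ha, G, hG, h1⟩ ⟨hb, H, hH, h2⟩
    refine ⟨add_mem ha hb, G + H, add_mem hG hH, fun x x' hl => ?_⟩
    exact congrArg₂ (· + ·) (h1 x x' hl) (h2 x x' hl)
  algebraMap_mem' r := ⟨Subalgebra.algebraMap_mem _ r, algebraMap ℝ _ r,
    Subalgebra.algebraMap_mem _ r, fun _ _ _ => rfl⟩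

variable {S S' f}

/-- The outputs `(C x)_k` and `(C' x')_k` of the two networks agree; their derivatives along the
input `α` are the outputs of the auxiliary systems. -/
theorem sum_field_eq_of_linked (hS : S.Realizes f) (hS' : S'.Realizes f) (k : Fin q) (α : 𝒰)
    {x : Fin n → ℝ} {x' : Fin n' → ℝ} (hl : S.Linked S' f x x') :
    ∑ l, S.C k l * S.field α x l = ∑ l, S'.C k l * S'.field α x' l := by
  let c := (ContinuousLinearMap.proj (R := ℝ) (φ := fun _ : Fin q => ℝ) k).comp
    (LinearMap.toContinuousLinearMap S.C.mulVecLin)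
  let c' := (ContinuousLinearMap.proj (R := ℝ) (φ := fun _ : Fin q => ℝ) k).comp
    (LinearMap.toContinuousLinearMap S'.C.mulVecLin)
  have h := Linked.fderiv_eq hS hS' c.differentiable c'.differentiable (by
    rintro _ _ ⟨u, t, ξ, ξ', hξ, hξ', rfl, rfl⟩
    exact congrFun ((hξ.2.2.2 t).symm.trans (hξ'.2.2.2 t)) k) α hl
  rw [c.fderiv, c'.fderiv] at h
  simpa [c, c', Matrix.mulVec, dotProduct] using h

theorem obsAlgebra_le_map_commonObs (hS : S.Realizes f) (hS' : S'.Realizes f)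
    (hV₀ : ∃ s, eval (fun l => D.ξ l s) D.V₀ ≠ 0)
    (hV : ∀ i, ∃ s, eval (fun l => D.ξ l s) (D.V i) ≠ 0) :
    (S.auxSystem D).obsAlgebra ≤ (commonObs D S S' f).map (AlgHom.fst ℝ _ _) := by
  refine sInf_le ⟨?_, ?_⟩
  · rintro ⟨k, α⟩
    refine ⟨(toRatFun ((S.auxSystem D).h₁ (k, α)) / toRatFun ((S.auxSystem D).h₂ (k, α)),
      ∑ l, S'.C k l • S'.compPreact D.σ_analytic l α), ⟨?_,
      ∑ l, S.C k l • S.compPreact D.σ_analytic l α, ?_, ?_⟩, rfl⟩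
    · exact sum_mem fun l _ =>
        Subalgebra.smul_mem _ (S'.compPreact_mem_auxFrac D _ D.σ_eq hV₀ l α) _
    · have h0 := (S.auxSystem D).h₂_ne_zero (k, α)
      refine ⟨(S.auxSystem D).h₁ (k, α), (S.auxSystem D).h₂ (k, α), h0, ?_, ?_⟩
      · exact mul_div_cancel₀ _ (toRatFun_ne_zero h0)
      refine Subtype.ext (funext fun x => ?_)
      rw [aeval_auxState_apply, ← S.eval_h₂_mul D k α x, ← aeval_auxState_apply]
      simp [compPreact_apply, field]
    · intro x x' hl
      have := sum_field_eq_of_linked hS hS' k α hl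
      simpa [compPreact_apply, field] using this
  · rintro α _ ⟨⟨g, G'⟩, ⟨hG', G, hG, h⟩, rfl⟩
    refine ⟨((S.auxSystem D).lieDeriv α g, S'.lie D α G'), ⟨S'.lie_mem_auxFrac D hV₀ hV α hG',
      S.lie D α G, (S.auxSystem D).lieDeriv_mem_ratRel α _ (S.aeval_Q_mul_lie D α) hG, ?_⟩, rfl⟩
    intro x x' hl
    exact Linked.fderiv_eq hS hS' (analyticAlgebra.differentiable G)
      (analyticAlgebra.differentiable G') h α hl

/-- A rational function that corresponds to the zero function on the states of `S'` has a
numerator vanishing on the reachable set. -/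
theorem eq_zero_of_mem_commonObs (hS : S.Realizes f) (hS' : S'.Realizes f)
    (huniq : (S.auxSystem D).HasUniqueTrajectories)
    (hreach : (S.auxSystem D).AlgebraicallyReachable) {g : RatFun (Fin D.N × Fin n × 𝒰)}
    (hg : (g, 0) ∈ commonObs D S S' f) : g = 0 := by
  obtain ⟨-, G, ⟨a, b, hb, h1, h2⟩, h⟩ := hg
  have ha : a = 0 := by
    refine hreach a fun z hz => ?_
    obtain ⟨x, x', hl, rfl⟩ := exists_linked_of_mem_reachableSet D hS hS' huniq hz
    rw [← aeval_auxState_apply, ← h2]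
    exact mul_eq_zero_of_right _ (h x x' hl)
  rw [ha, map_zero] at h1
  exact (mul_eq_zero.1 h1).resolve_left (toRatFun_ne_zero hb)

theorem trdeg_obsAlgebra_le (hS : S.Realizes f) (hS' : S'.Realizes f)
    (huniq : (S.auxSystem D).HasUniqueTrajectories)
    (hreach : (S.auxSystem D).AlgebraicallyReachable)
    (hV₀ : ∃ s, eval (fun l => D.ξ l s) D.V₀ ≠ 0)
    (hV : ∀ i, ∃ s, eval (fun l => D.ξ l s) (D.V i) ≠ 0) :
    Algebra.trdeg ℝ (S.auxSystem D).obsAlgebra ≤ Algebra.trdeg ℝ (S'.auxFrac D) := by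
  let π₁ := (AlgHom.fst ℝ (RatFun (Fin D.N × Fin n × 𝒰)) (analyticAlgebra (Fin n' → ℝ)))
  let π₂ : commonObs D S S' f →ₐ[ℝ] S'.auxFrac D :=
    ((AlgHom.snd ℝ (RatFun (Fin D.N × Fin n × 𝒰)) (analyticAlgebra (Fin n' → ℝ))).comp
      (commonObs D S S' f).val).codRestrict _ fun p => p.2.1
  have hπ₂ : Function.Injective π₂ := by
    rw [injective_iff_map_eq_zero]
    rintro ⟨⟨g, G'⟩, hp⟩ h0
    have hG' : G' = 0 := congrArg Subtype.val h0
    subst hG'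
    have hg := eq_zero_of_mem_commonObs D hS hS' huniq hreach hp
    subst hg
    rfl
  calc Algebra.trdeg ℝ (S.auxSystem D).obsAlgebra
      ≤ Algebra.trdeg ℝ ((commonObs D S S' f).map π₁) :=
        trdeg_le_of_injective (Subalgebra.inclusion (obsAlgebra_le_map_commonObs D hS hS' hV₀ hV))
          (Subalgebra.inclusion_injective _)
    _ ≤ Algebra.trdeg ℝ (commonObs D S S' f) := by
        refine trdeg_le_of_surjective ((π₁.comp (commonObs D S S' f).val).codRestrict _ fun p =>
          ⟨p.1, p.2, rfl⟩) ?_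
        rintro ⟨_, p, hp, rfl⟩
        exact ⟨⟨p, hp⟩, rfl⟩
    _ ≤ Algebra.trdeg ℝ (S'.auxFrac D) := trdeg_le_of_injective π₂ hπ₂

/-- If trajectories are unique, the reachable set consists of the points `ξ((A x + B α)_j)`, so
algebraic reachability prevents non-zero polynomials from vanishing along `ξ`. -/
theorem exists_eval_ne_zero (hS : S.Realizes f) (huniq : (S.auxSystem D).HasUniqueTrajectories)
    (hreach : (S.auxSystem D).AlgebraicallyReachable) (hn : 0 < n)
    {V : MvPolynomial (Fin D.N) ℝ} (hV : V ≠ 0) : ∃ s, eval (fun l => D.ξ l s) V ≠ 0 := by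
  by_contra! h
  obtain ⟨z, v, u, -⟩ := hreach.reachableSet_nonempty
  refine blockVar_ne_zero (⟨0, hn⟩ : Fin n) (u.1 0) hV (hreach _ fun z hz => ?_)
  obtain ⟨x, x', -, rfl⟩ := exists_linked_of_mem_reachableSet D hS hS huniq hz
  rw [eval_auxPoint_blockVar]
  exact h _

theorem isSigmaMinimal_of_semiAlgebraicallyObservable (hS : S.Realizes f)
    (huniq : (S.auxSystem D).HasUniqueTrajectories)
    (hobs : (S.auxSystem D).SemiAlgebraicallyObservable)
    (hreach : (S.auxSystem D).AlgebraicallyReachable) : S.IsSigmaMinimal f := by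
  refine ⟨hS, fun n' hn' S' hS' => ?_⟩
  have hn : 0 < n := (Nat.zero_le _).trans_lt hn'
  have h1 := (trdeg_obsAlgebra_le D hS hS' huniq hreach
    (exists_eval_ne_zero D hS huniq hreach hn D.V₀_ne_zero) fun i =>
    exists_eval_ne_zero D hS huniq hreach hn (D.V_ne_zero i)).trans (S'.trdeg_auxFrac_le D)
  rw [hobs, Nat.cast_le] at h1
  obtain ⟨z, v, u, -⟩ := hreach.reachableSet_nonempty
  have hcard : 0 < 𝒰.card := Finset.card_pos.2 ⟨_, (u.1 0).2⟩
  have h2 : D.N * (n' * 𝒰.card) < D.N * (n * 𝒰.card) :=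
    Nat.mul_lt_mul_of_pos_left (Nat.mul_lt_mul_of_pos_right hn' hcard) D.N_pos
  simp only [Fintype.card_prod, Fintype.card_fin, Fintype.card_coe] at h1
  omega

end Comparison

end RNN

/-! ### Polynomial systems -/

namespace RationalSystem

variable {𝒰 ι κ : Type} [Fintype ι]

theorem contDiff_eval (a : MvPolynomial ι ℝ) :
    ContDiff ℝ 1 fun x : ι → ℝ => MvPolynomial.eval x a := by
  refine contDiff_iff_contDiffAt.2 fun x => ?_
  have := AnalyticAt.aeval_mvPolynomial (𝕜 := ℝ) (f := fun (x : ι → ℝ) i => x i) (z := x)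
    (fun i => (ContinuousLinearMap.proj (R := ℝ) (φ := fun _ : ι => ℝ) i).analyticAt x) a
  simpa [MvPolynomial.coe_aeval_eq_eval] using this.contDiffAt

/-- Polynomial vector fields are Lipschitz on balls, so their trajectories are unique. -/
theorem IsPolynomial.hasUniqueTrajectories [Finite 𝒰] {R : RationalSystem 𝒰 ι κ}
    (hR : R.IsPolynomial) : R.HasUniqueTrajectories := by
  intro u v v' y y' hv hv' h0 h0'
  funext T
  obtain ⟨r, hr⟩ : ∃ r, ∀ t ≤ T, v t ∈ Metric.closedBall 0 r ∧ v' t ∈ Metric.closedBall 0 r := by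
    obtain ⟨r₁, h₁⟩ := (isCompact_Icc (a := (0 : ℝ≥0)) (b := T)).exists_bound_of_continuousOn
      hv.1.continuous.continuousOn
    obtain ⟨r₂, h₂⟩ := (isCompact_Icc (a := (0 : ℝ≥0)) (b := T)).exists_bound_of_continuousOn
      hv'.1.continuous.continuousOn
    refine ⟨max r₁ r₂, fun t ht => ⟨?_, ?_⟩⟩ <;> rw [mem_closedBall_zero_iff]
    · exact (h₁ t ⟨bot_le, ht⟩).trans (le_max_left _ _)
    · exact (h₂ t ⟨bot_le, ht⟩).trans (le_max_right _ _)
  have hL : ∀ α, ∃ K : ℝ≥0, LipschitzOnWith K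
      (fun x i => MvPolynomial.eval x (R.P α i)) (Metric.closedBall 0 r) := fun α =>
    (contDiff_pi.2 fun i => contDiff_eval (R.P α i)).contDiffOn.exists_lipschitzOnWith
      one_ne_zero (convex_closedBall _ _) (isCompact_closedBall _ _)
  choose K hK using hL
  obtain ⟨M, hM⟩ := Finite.exists_le K
  refine hv.1.eq_of_ae_deriv_dist_le hv'.1 (h0.trans h0'.symm) T M ?_
  filter_upwards [hv.2.1, hv'.2.1] with t ht ht' htpos htT
  obtain ⟨w, hw, hwe⟩ := ht htpos
  obtain ⟨w', hw', hwe'⟩ := ht' htpos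
  simp only [hR.1, map_one, mul_one] at hwe hwe'
  refine ⟨w, w', hw, hw', ?_⟩
  have hb := hr t.toNNReal (Real.toNNReal_le_iff_le_coe.2 htT)
  have h1 := (hK (u.1 t.toNNReal)).dist_le_mul _ hb.1 _ hb.2
  rw [dist_eq_norm, dist_eq_norm, ← funext hwe, ← funext hwe'] at h1
  exact h1.trans (mul_le_mul_of_nonneg_right (NNReal.coe_le_coe.2 (hM _)) (norm_nonneg _))

/-- A polynomial that vanishes on a non-empty open set is zero. -/
theorem Accessible.algebraicallyReachable {R : RationalSystem 𝒰 ι κ} (hR : R.Accessible) :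
    R.AlgebraicallyReachable := by
  obtain ⟨W, hW, ⟨z, hz⟩, hsub⟩ := hR
  intro g hg
  obtain ⟨ε, hε, hball⟩ := Metric.isOpen_iff.1 hW z hz
  refine MvPolynomial.funext_set (fun i => Metric.ball (z i) ε) (fun i => ?_) fun x hx => ?_
  · rw [Real.ball_eq_Ioo]
    exact Set.Ioo_infinite (by linarith)
  · rw [map_zero]
    refine hg x (hsub (hball ?_))
    rwa [ball_pi z hε]

theorem AlgebraicallyObservable.semiAlgebraicallyObservable {R : RationalSystem 𝒰 ι κ}
    (hR : R.AlgebraicallyObservable) : R.SemiAlgebraicallyObservable := by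
  have hmem : ∀ g, g ∈ R.obsAlgebra ↔ ∃ a, toRatFun a = g := fun g => by
    rw [hR]; rfl
  let e : MvPolynomial ι ℝ →ₐ[ℝ] R.obsAlgebra :=
    toRatFun.codRestrict R.obsAlgebra fun a => (hmem _).2 ⟨a, rfl⟩
  have he : Function.Bijective e := by
    refine ⟨fun a b hab => toRatFun_injective (congrArg Subtype.val hab), fun g => ?_⟩
    obtain ⟨a, ha⟩ := (hmem g.1).1 g.2
    exact ⟨a, Subtype.ext ha⟩
  rw [SemiAlgebraicallyObservable, ← (AlgEquiv.ofBijective e he).trdeg_eq,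
    MvPolynomial.trdeg_of_isDomain]
  simp

end RationalSystem

end

theorem mainTheorem3 {m q n : ℕ} (𝒰 : Finset (Fin m → ℝ)) (σ : ℝ → ℝ) (D : ActivationData σ)
    (S : RNN σ 𝒰 q n) (p : IOMap 𝒰 q) (hp : S.Realizes p)
    (h : ((S.auxSystem D).HasUniqueTrajectories ∧
          (S.auxSystem D).SemiAlgebraicallyObservable ∧
          (S.auxSystem D).AlgebraicallyReachable) ∨
        ((S.auxSystem D).IsPolynomial ∧
          (S.auxSystem D).AlgebraicallyObservable ∧
          (S.auxSystem D).AlgebraicallyReachable) ∨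
        ((S.auxSystem D).IsPolynomial ∧
          (S.auxSystem D).AlgebraicallyObservable ∧
          (S.auxSystem D).Accessible)) :
    S.IsSigmaMinimal p := by
  obtain ⟨h1, h2, h3⟩ | ⟨h1, h2, h3⟩ | ⟨h1, h2, h3⟩ := h
  · exact RNN.isSigmaMinimal_of_semiAlgebraicallyObservable D hp h1 h2 h3
  · exact RNN.isSigmaMinimal_of_semiAlgebraicallyObservable D hp h1.hasUniqueTrajectories
      h2.semiAlgebraicallyObservable h3
  · exact RNN.isSigmaMinimal_of_semiAlgebraicallyObservable D hp h1.hasUniqueTrajectories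
      h2.semiAlgebraicallyObservable h3.algebraicallyReachable
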